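/- **Setting.** Write points of $\mathbb{R}^2$ as $x=(x_1,x_2)$, let $\mathcal{L}^-=\mathbb{Z}^2\cap\{x_2\le 0\}$ be the substrate, let $\beta\in(0,1)$, $0<\varepsilon<\pi/10$ and $1<r_0<\sqrt2$. Let $v_2:[0,\infty)\to\mathbb{R}\cup\{+\infty\}$ satisfy: $v_2(1)=-1$ and $v_2(r)>-1$ for $r\ne1$; $v_2(r)=0$ for $r\ge r_0$; $v_2(r)>\varepsilon^{-1}$ for $r\in[0,1-\varepsilon]$. Let $v_3:[0,2\pi]\to\mathbb{R}$ satisfy: $v_3(\theta)=v_3(2\pi-\theta)$; $v_3=0$ on $\{\pi/2,\pi,3\pi/2\}$ and $v_3>0$ elsewhere; $v_3(\theta)\ge 4(\pi/10-\varepsilon)^{-1}|\theta-\pi|$ for $|\theta-\pi|\le\varepsilon$, with equality only if $\theta=\pi$; and $v_3(\theta)>\max\{1,2\beta\}\frac{4}{(1-\varepsilon)^2}\big(\sqrt2+\tfrac12\big)^2$ if $\theta$ has distance larger than $\varepsilon$ from each of $\pi/2,\pi,3\pi/2$. For a set $C\subset\mathbb{R}^2\cap\{x_2>0\}$ of $N$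 points put $$\mathcal{F}_\beta(C)=\frac12\sum_{\substack{x,y\in C\\ x\ne y}}v_2(|x-y|)+\beta\sum_{x\in C,\ z\in\mathcal{L}^-}v_2(|x-z|)+\frac12\sum_{(x,y,z)}v_3(\theta_{x,y,z}),$$ where the last sum runs over all ordered triples of pairwise distinct points of $C\cup\mathcal{L}^-$ with $|x-y|<r_0$ and $|y-z|<r_0$, and $\theta_{x,y,z}\in[0,2\pi)$ is the clockwise angle from $x-y$ to $z-y$. A *minimizer* with $N$ particles is a set of $N$ points in $\mathbb{R}^2\cap\{x_2>0\}$ that minimizes $\mathcal{F}_\beta$ among all such sets. For $N\ge1$ let $$m_\beta(N)=\min_{h\in\{1,\dots,N\}}\Big(2h+2(1-\beta)\Big\lceil\frac Nh\Big\rceil\Big),\qquad h_*(\beta,N)=\max\Big\{h\in\{1,\dots,N\}:\ 2h+2(1-\beta)\Big\lceil\frac Nh\Big\rceil=m_\beta(N)\Big\}.$$ **Corollary 2.5 (Winterbottom shape).** Let $\beta\in(0,1)$. Then $$N^{-1/2}\,h_*(\beta,N)\to\sqrt{1-\beta}\qquad\text{as } N\to\infty.$$ Moreover, suppose that for all sufficiently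 large $N$ the set $C_N=\{x^N_1,\dots,x^N_N\}\subset\mathbb{Z}^2\cap\{x_2>0\}$ is a minimizer of $\mathcal{F}_\beta$ with $N$ particles whose leftmost particles have first coordinate $1$. Then the rescaled empirical measures $\mu_N=\frac1N\sum_{j=1}^N\delta_{x^N_j/\sqrt N}$ converge weakly* as $N\to\infty$ (that is, tested against all continuous functions on $\mathbb{R}^2$ that vanish at infinity) to the restriction of Lebesgue measure on $\mathbb{R}^2$ to the rectangle $$\Big[0,\frac1{\sqrt{1-\beta}}\Big]\times\big[0,\sqrt{1-\beta}\big].$$ -/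

import Mathlib

open Filter Topology MeasureTheory

namespace Winterbottom

noncomputable section

/-- The Euclidean plane; the coordinates `x₁, x₂` of a point `x` are `x 0`, `x 1`. -/
abbrev Plane : Type := EuclideanSpace ℝ (Fin 2)

/-- The square lattice `ℤ²` inside the plane. -/
def squareLattice : Set Plane := {x | ∀ i, ∃ k : ℤ, x i = k}

/-- The open upper half plane `{x₂ > 0}`. -/
def upperHalf : Set Plane := {x | 0 < x 1}

/-- The substrate `ℤ² ∩ {x₂ ≤ 0}`. -/
def substrate : Set Plane := {z | z ∈ squareLattice ∧ z 1 ≤ 0}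

/-- A vector of the plane, as a complex number. -/
def toComplex (u : Plane) : ℂ := ⟨u 0, u 1⟩

/-- The bond angle at `y`: the angle in `[0, 2π)` by which one has to turn clockwise from the
direction of `x - y` to the direction of `z - y`. -/
def bondAngle (x y z : Plane) : ℝ :=
  toIcoMod Real.two_pi_pos 0 (toComplex (x - y) / toComplex (z - y)).arg

/-- The assumptions on the two-body potential `v₂ : [0, ∞) → ℝ ∪ {+∞}` and the three-body
potential `v₃ : [0, 2π] → ℝ`, with interaction range `r₀` and parameter `ε`. Values of `v₂` and
`v₃` outside `[0, ∞)` and `[0, 2π]` play no role; `v₂` never takes the value `-∞` on `[0, ∞)`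
because its minimum there is `-1`. -/
structure Admissible (β ε r₀ : ℝ) (v₂ : ℝ → EReal) (v₃ : ℝ → ℝ) : Prop where
  v₂_one : v₂ 1 = -1
  v₂_min : ∀ r, 0 ≤ r → r ≠ 1 → -1 < v₂ r
  one_lt_range : 1 < r₀
  range_lt_sqrt_two : r₀ < √2
  v₂_far : ∀ r, r₀ ≤ r → v₂ r = 0
  v₂_near : ∀ r, 0 ≤ r → r ≤ 1 - ε → ((ε⁻¹ : ℝ) : EReal) < v₂ r
  v₃_symm : ∀ θ ∈ Set.Icc 0 (2 * Real.pi), v₃ θ = v₃ (2 * Real.pi - θ)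
  v₃_zero : ∀ θ ∈ ({Real.pi / 2, Real.pi, 3 * Real.pi / 2} : Set ℝ), v₃ θ = 0
  v₃_pos : ∀ θ ∈ Set.Icc 0 (2 * Real.pi),
    θ ∉ ({Real.pi / 2, Real.pi, 3 * Real.pi / 2} : Set ℝ) → 0 < v₃ θ
  v₃_slope : ∀ θ ∈ Set.Icc (Real.pi - ε) (Real.pi + ε),
    4 * (Real.pi / 10 - ε)⁻¹ * |θ - Real.pi| ≤ v₃ θ
  v₃_slope_strict : ∀ θ ∈ Set.Icc (Real.pi - ε) (Real.pi + ε),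
    v₃ θ = 4 * (Real.pi / 10 - ε)⁻¹ * |θ - Real.pi| → θ = Real.pi
  v₃_large : ∀ θ ∈ Set.Icc 0 (2 * Real.pi),
    θ ∉ Set.Icc (Real.pi / 2 - ε) (Real.pi / 2 + ε) ∪ Set.Icc (Real.pi - ε) (Real.pi + ε) ∪
      Set.Icc (3 * Real.pi / 2 - ε) (3 * Real.pi / 2 + ε) →
    max 1 (2 * β) * (4 / (1 - ε) ^ 2) * (√2 + 1 / 2) ^ 2 < v₃ θ

/-- The ordered triples `(x, y, z)` of pairwise distinct points of `C ∪ substrate` such that `x`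
and `z` are closer than `r₀` to `y`. -/
def bondTriples (r₀ : ℝ) (C : Finset Plane) : Set (Plane × Plane × Plane) :=
  {t | t.1 ∈ (C : Set Plane) ∪ substrate ∧ t.2.1 ∈ (C : Set Plane) ∪ substrate ∧
    t.2.2 ∈ (C : Set Plane) ∪ substrate ∧
    t.1 ≠ t.2.1 ∧ t.2.1 ≠ t.2.2 ∧ t.1 ≠ t.2.2 ∧
    dist t.1 t.2.1 < r₀ ∧ dist t.2.1 t.2.2 < r₀}

/-- The energy of a configuration `C` of particles. For admissible potentials both sums that are
written with `∑ᶠ` have finitely many nonzero terms: `v₂` vanishes beyond distance `r₀`, and a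
triple that lies entirely in the substrate has angle `π/2`, `π` or `3π/2`, where `v₃` is `0`. -/
def energy (β r₀ : ℝ) (v₂ : ℝ → EReal) (v₃ : ℝ → ℝ) (C : Finset Plane) : EReal :=
  ((1 / 2 : ℝ) : EReal) * (∑ p ∈ C.offDiag, v₂ (dist p.1 p.2))
    + (β : EReal) * (∑ x ∈ C, ∑ᶠ z ∈ substrate, v₂ (dist x z))
    + (((1 / 2 : ℝ) * ∑ᶠ t ∈ bondTriples r₀ C, v₃ (bondAngle t.1 t.2.1 t.2.2) : ℝ) : EReal)

/-- The configurations of `N` (distinct) particles in the upper half plane. -/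
def configurations (N : ℕ) : Set (Finset Plane) :=
  {C | C.card = N ∧ (C : Set Plane) ⊆ upperHalf}

/-- `C` has minimal energy among all configurations of `N` particles in the upper half plane. -/
def IsMinimizer (β r₀ : ℝ) (v₂ : ℝ → EReal) (v₃ : ℝ → ℝ) (N : ℕ) (C : Finset Plane) : Prop :=
  C ∈ configurations N ∧ IsMinOn (energy β r₀ v₂ v₃) (configurations N) C

/-- The leftmost particles of `C` have first coordinate `1`. -/
def LeftNormalized (C : Finset Plane) : Prop :=
  IsLeast ((fun x : Plane => x 0) '' (C : Set Plane)) 1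

/-- The normalized energy `2h + 2(1-β)⌈N/h⌉` of a lattice rectangle of height `h`. -/
def heightEnergy (β : ℝ) (N h : ℕ) : ℝ :=
  2 * (h : ℝ) + 2 * (1 - β) * (⌈(N : ℝ) / (h : ℝ)⌉ : ℝ)

/-- The normalized minimal energy, a minimum over `h ∈ {1, …, N}` (for `N ≥ 1`). -/
def minEnergy (β : ℝ) (N : ℕ) : ℝ := sInf (heightEnergy β N '' Set.Icc 1 N)

/-- The largest optimal height, a maximum of a finite set (nonempty for `N ≥ 1`). -/
def hStar (β : ℝ) (N : ℕ) : ℕ := sSup {h | h ∈ Set.Icc 1 N ∧ heightEnergy β N h = minEnergy β N}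

/-- The rescaled empirical measure `(1/N) ∑_{x ∈ C} δ_{x/√N}`, where `N` is the number of points
of `C`. -/
def empiricalMeasure (C : Finset Plane) : Measure Plane :=
  (C.card : ENNReal)⁻¹ • ∑ x ∈ C, Measure.dirac ((√(C.card : ℝ))⁻¹ • x)

/-- Weak* convergence of finite measures on the plane: convergence of the integrals of all
continuous functions that vanish at infinity. -/
def WeakStarTendsto (μ : ℕ → Measure Plane) (ν : Measure Plane) : Prop :=
  ∀ f : ZeroAtInftyContinuousMap Plane ℝ,
    Tendsto (fun N => ∫ x, f x ∂(μ N)) atTop (𝓝 (∫ x, f x ∂ν))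

/-- The rectangle `[0, 1/√(1-β)] × [0, √(1-β)]`. -/
def winterbottomRectangle (β : ℝ) : Set Plane :=
  {x | x 0 ∈ Set.Icc 0 (1 / √(1 - β)) ∧ x 1 ∈ Set.Icc 0 (√(1 - β))}

end

end Winterbottom

open Winterbottom

/-!
Since the minimizers are assumed to lie in `ℤ²`, their energy is purely combinatorial. Bond angles
in the lattice are right or straight, so that the three-body term vanishes, `v₂` only sees nearest
neighbours, and a configuration of `N` lattice points has energy `-2N + R + U - β s`, where `R` and
`U` count its right and upper ends (points whose right, respectively upper, neighbour is missing)
and `s` counts the points at height `1` (`Admissible.energy_map`).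

If the configuration occupies `h` rows and `w` columns, then `R ≥ h`, `U ≥ w ≥ s` and `w h ≥ N`, so
the energy is at least `-2N + h + (1 - β) ⌈N / h⌉`. Filling the columns of a half strip of height
`h` one after the other attains this value. A minimizer therefore has equality throughout: its rows
and columns are intervals, each column starts at the substrate, `w = ⌈N / h⌉`, and `h` is an optimal
height. So it lies in the box `[1, ⌈N / h⌉] × [1, h]` (`Admissible.minimizer_subset_box`).

Comparison with the height `⌈√(1-β) √N⌉` gives `(h - √(1-β) √N)² ≤ 4 (√N + 1)` for every optimal
height (`sq_sub_le_of_optimal`), hence `h / √N → √(1-β)` and `⌈N / h⌉ / √N → 1 / √(1-β)`. In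
particular the box has `N + o(N)` points, so that the empirical measures have the same limit as the
normalized counting measures of the boxes, whose integrals are Riemann sums (`tendsto_box_sum`).
-/

namespace Winterbottom
open Finset

/-! ### Finite subsets of `ℤ²` and their ends -/

/-- The points of `A` whose right neighbour is missing. -/
def rightEnds (A : Finset (ℤ × ℤ)) : Finset (ℤ × ℤ) := {a ∈ A | (a.1 + 1, a.2) ∉ A}

/-- The points of `A` whose upper neighbour is missing. -/
def upperEnds (A : Finset (ℤ × ℤ)) : Finset (ℤ × ℤ) := {a ∈ A | (a.1, a.2 + 1) ∉ A}

/-- The points of `A` at height `1`, which are those bonded to the substrate. -/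
def base (A : Finset (ℤ × ℤ)) : Finset (ℤ × ℤ) := {a ∈ A | a.2 = 1}

/-- The heights of the nonempty rows of `A`. -/
def rows (A : Finset (ℤ × ℤ)) : Finset ℤ := A.image Prod.snd

/-- The abscissae of the nonempty columns of `A`. -/
def cols (A : Finset (ℤ × ℤ)) : Finset ℤ := A.image Prod.fst

lemma rows_subset_image_rightEnds (A : Finset (ℤ × ℤ)) :
    rows A ⊆ (rightEnds A).image Prod.snd := by
  intro j hj
  obtain ⟨a, ha, rfl⟩ := mem_image.1 hj
  obtain ⟨b, hb, hmax⟩ := ({b ∈ A | b.2 = a.2} : Finset _).exists_max_image Prod.fst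
    ⟨a, by simp [ha]⟩
  rw [mem_filter] at hb
  refine mem_image.2 ⟨b, mem_filter.2 ⟨hb.1, fun h => ?_⟩, hb.2⟩
  have := hmax _ (mem_filter.2 ⟨h, hb.2⟩)
  simp at this

lemma card_rows_le (A : Finset (ℤ × ℤ)) : #(rows A) ≤ #(rightEnds A) :=
  (card_le_card (rows_subset_image_rightEnds A)).trans card_image_le

/-- If there are no more right ends than nonempty rows, every row is an interval. -/
lemma mem_of_card_rightEnds_le {A : Finset (ℤ × ℤ)} (h : #(rightEnds A) ≤ #(rows A))
    {a b i j : ℤ} (ha : (a, j) ∈ A) (hb : (b, j) ∈ A) (hai : a ≤ i) (hib : i ≤ b) :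
    (i, j) ∈ A := by
  have hinj : Set.InjOn Prod.snd (rightEnds A : Set (ℤ × ℤ)) := card_image_iff.1 <|
    le_antisymm card_image_le (h.trans (card_le_card (rows_subset_image_rightEnds A)))
  by_contra hi
  -- A missing point between two points of a row would separate two right ends of that row.
  obtain ⟨c, hc, hcmax⟩ := ({c ∈ A | c.2 = j ∧ c.1 < i} : Finset _).exists_max_image Prod.fst
    ⟨(a, j), by
      have : a ≠ i := by rintro rfl; exact hi ha
      simp only [mem_filter, true_and]; exact ⟨ha, by omega⟩⟩
  obtain ⟨d, hd, hdmax⟩ := ({d ∈ A | d.2 = j} : Finset _).exists_max_image Prod.fst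
    ⟨(b, j), by simp [hb]⟩
  obtain ⟨c₁, c₂⟩ := c
  obtain ⟨d₁, d₂⟩ := d
  simp only [mem_filter] at hc hd
  obtain ⟨hcA, rfl, hci⟩ := hc
  obtain ⟨hdA, rfl⟩ := hd
  have hce : (c₁, d₂) ∈ rightEnds A := mem_filter.2 ⟨hcA, fun hmem => by
    rcases eq_or_ne (c₁ + 1) i with rfl | hne
    · exact hi hmem
    · have := hcmax (c₁ + 1, d₂) (mem_filter.2 ⟨hmem, rfl, by simp only; omega⟩)
      simp at this⟩
  have hde : (d₁, d₂) ∈ rightEnds A := mem_filter.2 ⟨hdA, fun hmem => by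
    have := hdmax (d₁ + 1, d₂) (mem_filter.2 ⟨hmem, rfl⟩)
    simp at this⟩
  have hcd := hinj hce hde rfl
  have := hdmax (b, d₂) (mem_filter.2 ⟨hb, rfl⟩)
  simp only [Prod.mk.injEq, and_true] at hcd this
  omega

lemma card_rightEnds_swap (A : Finset (ℤ × ℤ)) :
    #(rightEnds (A.image Prod.swap)) = #(upperEnds A) := by
  rw [← card_image_of_injective (upperEnds A) Prod.swap_injective]
  congr 1
  ext ⟨i, j⟩
  simp [rightEnds, upperEnds, Prod.swap_eq_iff_eq_swap]

lemma rows_swap (A : Finset (ℤ × ℤ)) : rows (A.image Prod.swap) = cols A := by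
  simp [rows, cols, image_image, Function.comp_def]

lemma card_cols_le (A : Finset (ℤ × ℤ)) : #(cols A) ≤ #(upperEnds A) := by
  simpa [card_rightEnds_swap, rows_swap] using card_rows_le (A.image Prod.swap)

/-- If there are no more upper ends than nonempty columns, every column is an interval. -/
lemma mem_of_card_upperEnds_le {A : Finset (ℤ × ℤ)} (h : #(upperEnds A) ≤ #(cols A))
    {a b i j : ℤ} (ha : (j, a) ∈ A) (hb : (j, b) ∈ A) (hai : a ≤ i) (hib : i ≤ b) :
    (j, i) ∈ A := by
  have := mem_of_card_rightEnds_le (A := A.image Prod.swap) (a := a) (b := b) (i := i) (j := j)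
    (by rwa [card_rightEnds_swap, rows_swap])
    (mem_image.2 ⟨_, ha, rfl⟩) (mem_image.2 ⟨_, hb, rfl⟩) hai hib
  simpa [Prod.swap_eq_iff_eq_swap] using this

lemma base_injOn (A : Finset (ℤ × ℤ)) : Set.InjOn Prod.fst (base A : Set (ℤ × ℤ)) := by
  rintro ⟨a, b⟩ h ⟨c, d⟩ h' (rfl : a = c)
  simp_all [base]

lemma image_base_subset (A : Finset (ℤ × ℤ)) : (base A).image Prod.fst ⊆ cols A :=
  image_subset_image (filter_subset _ _)

lemma card_base_le (A : Finset (ℤ × ℤ)) : #(base A) ≤ #(cols A) := by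
  rw [← card_image_of_injOn (base_injOn A)]
  exact card_le_card (image_base_subset A)

lemma card_le_cols_mul_rows (A : Finset (ℤ × ℤ)) : #A ≤ #(cols A) * #(rows A) := by
  rw [← card_product]
  exact card_le_card fun a ha => mem_product.2 ⟨mem_image_of_mem _ ha, mem_image_of_mem _ ha⟩

/-- A configuration in `{x₂ ≥ 1}` with abscissae at least `1`, one of them equal to `1`, that has
as few ends as its numbers of rows and columns permit and whose columns all touch the substrate,
lies in the box `[1, #cols] × [1, #rows]`. -/
lemma subset_box {A : Finset (ℤ × ℤ)} (hpos : ∀ a ∈ A, 0 < a.2)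
    (hleft : ∀ a ∈ A, 1 ≤ a.1) (hone : ∃ a ∈ A, a.1 = 1)
    (hR : #(rightEnds A) ≤ #(rows A)) (hU : #(upperEnds A) ≤ #(cols A))
    (hb : #(cols A) ≤ #(base A)) :
    A ⊆ Icc 1 (#(cols A) : ℤ) ×ˢ Icc 1 (#(rows A) : ℤ) := by
  have hcb : (base A).image Prod.fst = cols A := eq_of_subset_of_card_le (image_base_subset A) <| by
    rwa [card_image_of_injOn (base_injOn A)]
  have hbot : ∀ a ∈ A, (a.1, (1 : ℤ)) ∈ A := by
    intro a ha
    have : a.1 ∈ (base A).image Prod.fst := hcb ▸ mem_image_of_mem _ ha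
    obtain ⟨⟨c, d⟩, hc, hca⟩ := mem_image.1 this
    simp only [base, mem_filter] at hc
    obtain ⟨hc, rfl⟩ := hc
    exact hca ▸ hc
  obtain ⟨a₀, ha₀, h₀⟩ := hone
  have h11 : ((1 : ℤ), (1 : ℤ)) ∈ A := h₀ ▸ hbot a₀ ha₀
  intro a ha
  have h1 : Icc 1 a.1 ⊆ cols A := fun i hi => by
    rw [mem_Icc] at hi
    exact mem_image_of_mem Prod.fst (mem_of_card_rightEnds_le hR h11 (hbot a ha) hi.1 hi.2)
  have h2 : Icc 1 a.2 ⊆ rows A := fun i hi => by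
    rw [mem_Icc] at hi
    exact mem_image_of_mem Prod.snd
      (mem_of_card_upperEnds_le hU (hbot a ha) (show (a.1, a.2) ∈ A from ha) hi.1 hi.2)
  have h1 := card_le_card h1
  have h2 := card_le_card h2
  have := hpos a ha
  have := hleft a ha
  simp only [Int.card_Icc, mem_product, mem_Icc] at *
  omega

/-! ### The bonds of a lattice configuration -/

lemma card_add_mem_eq_card_sub_mem (A : Finset (ℤ × ℤ)) (d : ℤ × ℤ) :
    #{a ∈ A | a - d ∈ A} = #{a ∈ A | a + d ∈ A} := by
  refine card_bij' (fun a _ => a - d) (fun a _ => a + d) ?_ ?_ ?_ ?_ <;> simp +contextual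

lemma int_sq_add_sq_eq_one {x y : ℤ} (h : x ^ 2 + y ^ 2 = 1) :
    (x = 1 ∧ y = 0) ∨ (x = -1 ∧ y = 0) ∨ (x = 0 ∧ y = 1) ∨ (x = 0 ∧ y = -1) := by
  have h1 : -1 ≤ x := by nlinarith [sq_nonneg y]
  have h2 : x ≤ 1 := by nlinarith [sq_nonneg y]
  have h3 : -1 ≤ y := by nlinarith [sq_nonneg x]
  have h4 : y ≤ 1 := by nlinarith [sq_nonneg x]
  interval_cases x <;> interval_cases y <;> simp_all

/-- The number of ordered pairs of lattice neighbours in `A`. -/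
lemma card_adjacent (A : Finset (ℤ × ℤ)) :
    (#{p ∈ A.offDiag | (p.1.1 - p.2.1) ^ 2 + (p.1.2 - p.2.2) ^ 2 = 1} : ℤ) =
      2 * (2 * #A - #(rightEnds A) - #(upperEnds A)) := by
  have key : ({p ∈ A.offDiag | (p.1.1 - p.2.1) ^ 2 + (p.1.2 - p.2.2) ^ 2 = 1} : Finset _) =
      ((({a ∈ A | a + ((1, 0) : ℤ × ℤ) ∈ A} : Finset _).image (fun a => (a, a + (1, 0)))) ∪
      (({a ∈ A | a - ((1, 0) : ℤ × ℤ) ∈ A} : Finset _).image (fun a => (a, a - (1, 0))))) ∪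
      ((({a ∈ A | a + ((0, 1) : ℤ × ℤ) ∈ A} : Finset _).image (fun a => (a, a + (0, 1)))) ∪
      (({a ∈ A | a - ((0, 1) : ℤ × ℤ) ∈ A} : Finset _).image (fun a => (a, a - (0, 1))))) := by
    ext ⟨⟨a, b⟩, ⟨c, d⟩⟩
    simp only [mem_filter, mem_offDiag, mem_union, mem_image, Prod.mk.injEq, Prod.exists,
      Prod.mk_add_mk, Prod.mk_sub_mk, add_zero, sub_zero]
    constructor
    · rintro ⟨⟨h1, h2, -⟩, h⟩
      rcases int_sq_add_sq_eq_one h with ⟨hx, hy⟩ | ⟨hx, hy⟩ | ⟨hx, hy⟩ | ⟨hx, hy⟩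
      · obtain rfl : c = a - 1 := by omega
        obtain rfl : d = b := by omega
        exact .inl <| .inr ⟨a, d, ⟨h1, h2⟩, by simp⟩
      · obtain rfl : c = a + 1 := by omega
        obtain rfl : d = b := by omega
        exact .inl <| .inl ⟨a, d, ⟨h1, h2⟩, by simp⟩
      · obtain rfl : c = a := by omega
        obtain rfl : d = b - 1 := by omega
        exact .inr <| .inr ⟨c, b, ⟨h1, h2⟩, by simp⟩
      · obtain rfl : c = a := by omega
        obtain rfl : d = b + 1 := by omega
        exact .inr <| .inl ⟨c, b, ⟨h1, h2⟩, by simp⟩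
    · rintro ((⟨p, q, ⟨h1, h2⟩, ⟨rfl, rfl⟩, rfl, rfl⟩ | ⟨p, q, ⟨h1, h2⟩, ⟨rfl, rfl⟩, rfl, rfl⟩) |
        (⟨p, q, ⟨h1, h2⟩, ⟨rfl, rfl⟩, rfl, rfl⟩ | ⟨p, q, ⟨h1, h2⟩, ⟨rfl, rfl⟩, rfl, rfl⟩)) <;>
      exact ⟨⟨h1, h2, by simp only [ne_eq, Prod.mk.injEq]; omega⟩, by ring⟩
  have hR : #{a ∈ A | a + ((1, 0) : ℤ × ℤ) ∈ A} + #(rightEnds A) = #A := by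
    simpa [rightEnds, Prod.add_def] using
      card_filter_add_card_filter_not (s := A) (fun a => a + ((1, 0) : ℤ × ℤ) ∈ A)
  have hU : #{a ∈ A | a + ((0, 1) : ℤ × ℤ) ∈ A} + #(upperEnds A) = #A := by
    simpa [upperEnds, Prod.add_def] using
      card_filter_add_card_filter_not (s := A) (fun a => a + ((0, 1) : ℤ × ℤ) ∈ A)
  rw [key, card_union_of_disjoint, card_union_of_disjoint, card_union_of_disjoint,
    card_image_of_injective _ fun a b h => (Prod.ext_iff.1 h).1,
    card_image_of_injective _ fun a b h => (Prod.ext_iff.1 h).1,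
    card_image_of_injective _ fun a b h => (Prod.ext_iff.1 h).1,
    card_image_of_injective _ fun a b h => (Prod.ext_iff.1 h).1,
    card_add_mem_eq_card_sub_mem, card_add_mem_eq_card_sub_mem]
  · push_cast
    omega
  all_goals
    simp only [disjoint_left, mem_union, mem_image, Prod.exists, Prod.forall, Prod.mk.injEq,
      Prod.mk_add_mk, Prod.mk_sub_mk]
  · rintro a b c d ⟨p, q, -, h⟩ ⟨p', q', -, h'⟩
    omega
  · rintro a b c d ⟨p, q, -, h⟩ ⟨p', q', -, h'⟩
    omega
  · rintro a b c d (⟨p, q, -, h⟩ | ⟨p, q, -, h⟩) (⟨p', q', -, h'⟩ | ⟨p', q', -, h'⟩) <;> omega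

/-! ### Filling the columns one after the other -/

/-- The first `N` points of the half strip of height `h`, column by column and from bottom to top
in each column. -/
def columnFilling (N h : ℕ) : Finset (ℤ × ℤ) :=
  (range N).image fun k => (((k / h : ℕ) : ℤ) + 1, ((k % h : ℕ) : ℤ) + 1)

lemma card_columnFilling (N h : ℕ) : #(columnFilling N h) = N := by
  rw [columnFilling, card_image_of_injective, card_range]
  intro k l hkl
  simp only [Prod.mk.injEq, add_left_inj, Nat.cast_inj] at hkl
  rw [← Nat.div_add_mod k h, ← Nat.div_add_mod l h, hkl.1, hkl.2]

lemma mem_columnFilling {N h : ℕ} (hh : 0 < h) {i j : ℤ} :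
    (i, j) ∈ columnFilling N h ↔ 1 ≤ i ∧ 1 ≤ j ∧ j ≤ h ∧ (i - 1) * h + j ≤ N := by
  simp only [columnFilling, mem_image, mem_range, Prod.mk.injEq]
  constructor
  · rintro ⟨k, hk, rfl, rfl⟩
    have h1 := Nat.mod_lt k hh
    have h2 : ((k / h : ℕ) : ℤ) * h + (k % h : ℕ) = k := mod_cast Nat.div_add_mod' k h
    refine ⟨le_add_of_nonneg_left (Int.natCast_nonneg _), by omega, by omega, ?_⟩
    rw [add_sub_cancel_right]
    omega
  · rintro ⟨h1, h2, h3, h4⟩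
    obtain ⟨p, rfl⟩ : ∃ p : ℕ, i = p + 1 := ⟨(i - 1).toNat, by omega⟩
    obtain ⟨q, rfl⟩ : ∃ q : ℕ, j = q + 1 := ⟨(j - 1).toNat, by omega⟩
    have hq : q < h := by omega
    refine ⟨p * h + q, ?_, ?_, ?_⟩
    · zify
      rw [add_sub_cancel_right] at h4
      omega
    · rw [mul_comm, Nat.mul_add_div hh, Nat.div_eq_of_lt hq, add_zero]
    · rw [mul_comm, Nat.mul_add_mod, Nat.mod_eq_of_lt hq]

lemma card_rightEnds_columnFilling {N h : ℕ} (hh : 0 < h) :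
    #(rightEnds (columnFilling N h)) ≤ h := by
  have : #(Icc (1 : ℤ) h) = h := by simp
  nth_rw 2 [← this]
  refine card_le_card_of_injOn Prod.snd ?_ ?_
  · rintro ⟨i, j⟩ hij
    simp only [rightEnds, coe_filter, Set.mem_ofPred_eq, mem_columnFilling hh] at hij
    simp only [coe_Icc, Set.mem_Icc]
    omega
  · rintro ⟨i, j⟩ hij ⟨k, l⟩ hkl (rfl : j = l)
    simp only [rightEnds, coe_filter, Set.mem_ofPred_eq, mem_columnFilling hh] at hij hkl
    have h0 : (0 : ℤ) < h := by omega
    have h1 : (N : ℤ) < (i + 1 - 1) * h + j := by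
      by_contra hc
      exact hij.2 ⟨by omega, hij.1.2.1, hij.1.2.2.1, by omega⟩
    have h2 : (N : ℤ) < (k + 1 - 1) * h + j := by
      by_contra hc
      exact hkl.2 ⟨by omega, hij.1.2.1, hij.1.2.2.1, by omega⟩
    have h3 : i - 1 < k := by
      have := hij.1.2.2.2
      by_contra! hc
      nlinarith [mul_le_mul_of_nonneg_right hc h0.le]
    have h4 : k - 1 < i := by
      have := hkl.1.2.2.2
      by_contra! hc
      nlinarith [mul_le_mul_of_nonneg_right hc h0.le]
    simp only [Prod.mk.injEq, and_true]
    omega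

/-- Upper and lower ends are equinumerous, and the lower ends of the filling are at height `1`. -/
lemma card_upperEnds_columnFilling {N h : ℕ} (hh : 0 < h) :
    #(upperEnds (columnFilling N h)) ≤ #(base (columnFilling N h)) := by
  set A := columnFilling N h with hA
  have h1 : #{a ∈ A | a + ((0, 1) : ℤ × ℤ) ∈ A} + #(upperEnds A) = #A := by
    simpa [upperEnds, Prod.add_def] using
      card_filter_add_card_filter_not (s := A) (fun a => a + ((0, 1) : ℤ × ℤ) ∈ A)
  have h2 := card_filter_add_card_filter_not (s := A) (fun a => a - ((0, 1) : ℤ × ℤ) ∈ A)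
  rw [card_add_mem_eq_card_sub_mem] at h2
  have h3 : ({a ∈ A | ¬ a - ((0, 1) : ℤ × ℤ) ∈ A} : Finset _) ⊆ base A := by
    rintro ⟨i, j⟩ hij
    simp only [base, mem_filter, Prod.mk_sub_mk, sub_zero, hA, mem_columnFilling hh] at hij ⊢
    refine ⟨hij.1, ?_⟩
    by_contra hc
    exact hij.2 ⟨by omega, by omega, by omega, by omega⟩
  have := card_le_card h3
  omega

lemma card_base_columnFilling {N h : ℕ} (hh : 0 < h) :
    (#(base (columnFilling N h)) : ℤ) ≤ ⌈(N : ℝ) / h⌉ := by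
  have h0 : 0 ≤ ⌈(N : ℝ) / h⌉ := Int.ceil_nonneg (by positivity)
  have : #(base (columnFilling N h)) ≤ #(Icc 1 ⌈(N : ℝ) / h⌉) := by
    refine card_le_card_of_injOn Prod.fst ?_ (base_injOn _)
    rintro ⟨i, j⟩ hij
    simp only [base, coe_filter, Set.mem_ofPred_eq, mem_columnFilling hh] at hij
    obtain ⟨⟨h1, -, -, h4⟩, rfl⟩ := hij
    simp only [coe_Icc, Set.mem_Icc]
    refine ⟨h1, ?_⟩
    have h5 : ((i - 1 : ℤ) : ℝ) < N / h := by
      rw [lt_div_iff₀ (by positivity)]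
      exact_mod_cast show (i - 1) * (h : ℤ) < N by omega
    have := Int.lt_ceil.2 h5
    omega
  rw [Int.card_Icc] at this
  omega

/-! ### The energy of a lattice configuration -/

/-- The lattice `ℤ²` as a subset of the plane. -/
def latticePoint : ℤ × ℤ ↪ Plane where
  toFun k := !₂[(k.1 : ℝ), (k.2 : ℝ)]
  inj' := by
    rintro ⟨a, b⟩ ⟨c, d⟩ h
    have h0 := congrArg (fun x : Plane => x 0) h
    have h1 := congrArg (fun x : Plane => x 1) h
    simp at h0 h1
    simp [h0, h1]

@[simp] lemma latticePoint_zero (k : ℤ × ℤ) : latticePoint k 0 = k.1 := rfl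

@[simp] lemma latticePoint_one (k : ℤ × ℤ) : latticePoint k 1 = k.2 := rfl

lemma exists_latticePoint {x : Plane} (hx : x ∈ squareLattice) : ∃ k, latticePoint k = x := by
  obtain ⟨i, hi⟩ := hx 0
  obtain ⟨j, hj⟩ := hx 1
  refine ⟨(i, j), ?_⟩
  ext l
  fin_cases l
  · simp [hi]
  · simp [hj]

lemma latticePoint_mem (k : ℤ × ℤ) : latticePoint k ∈ squareLattice := by
  intro l
  fin_cases l
  · exact ⟨k.1, rfl⟩
  · exact ⟨k.2, rfl⟩

lemma exists_map_latticePoint {C : Finset Plane} (hC : (C : Set Plane) ⊆ squareLattice) :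
    ∃ A : Finset (ℤ × ℤ), C = A.map latticePoint := by
  refine ⟨C.preimage latticePoint latticePoint.injective.injOn, ?_⟩
  ext x
  simp only [Finset.mem_map, mem_preimage]
  constructor
  · intro hx
    obtain ⟨k, rfl⟩ := exists_latticePoint (hC hx)
    exact ⟨k, hx, rfl⟩
  · rintro ⟨k, hk, rfl⟩
    exact hk

lemma dist_latticePoint (a b : ℤ × ℤ) :
    dist (latticePoint a) (latticePoint b) =
      √(((a.1 - b.1) ^ 2 + (a.2 - b.2) ^ 2 : ℤ) : ℝ) := by
  rw [EuclideanSpace.dist_eq, Fin.sum_univ_two]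
  simp [Real.dist_eq, sq_abs]

lemma int_sq_add_sq_pos {a b : ℤ × ℤ} (hab : a ≠ b) :
    0 < (a.1 - b.1) ^ 2 + (a.2 - b.2) ^ 2 := by
  by_contra! h
  apply hab
  ext <;> nlinarith [sq_nonneg (a.1 - b.1), sq_nonneg (a.2 - b.2)]

variable {β ε r₀ : ℝ} {v₂ : ℝ → EReal} {v₃ : ℝ → ℝ}

/-- Distinct lattice points interact through `v₂` only if they are nearest neighbours. -/
lemma Admissible.v₂_latticePoint (h : Admissible β ε r₀ v₂ v₃) {a b : ℤ × ℤ} (hab : a ≠ b) :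
    v₂ (dist (latticePoint a) (latticePoint b)) =
      ((if (a.1 - b.1) ^ 2 + (a.2 - b.2) ^ 2 = 1 then -1 else 0 : ℝ) : EReal) := by
  rw [dist_latticePoint]
  have hpos := int_sq_add_sq_pos hab
  split_ifs with h1
  · rw [h1, Int.cast_one, Real.sqrt_one, h.v₂_one]
    norm_num
  · rw [h.v₂_far, EReal.coe_zero]
    refine h.range_lt_sqrt_two.le.trans (Real.sqrt_le_sqrt ?_)
    have : 2 ≤ (a.1 - b.1) ^ 2 + (a.2 - b.2) ^ 2 := by omega
    exact_mod_cast this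

lemma ereal_coe_sum {ι : Type*} (s : Finset ι) (f : ι → ℝ) :
    ((∑ i ∈ s, f i : ℝ) : EReal) = ∑ i ∈ s, (f i : EReal) := by
  classical
  induction s using Finset.induction_on with
  | empty => simp
  | insert i s hi ih => rw [sum_insert hi, sum_insert hi, EReal.coe_add, ih]

lemma Admissible.sum_pair (h : Admissible β ε r₀ v₂ v₃) (A : Finset (ℤ × ℤ)) :
    ∑ p ∈ (A.map latticePoint).offDiag, v₂ (dist p.1 p.2) =
      ((-(2 * (2 * #A - #(rightEnds A) - #(upperEnds A))) : ℝ) : EReal) := by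
  have h1 : ∑ p ∈ (A.map latticePoint).offDiag, v₂ (dist p.1 p.2) =
      ∑ p ∈ A.offDiag, v₂ (dist (latticePoint p.1) (latticePoint p.2)) := by
    symm
    refine sum_bij (fun p _ => (latticePoint p.1, latticePoint p.2)) ?_ ?_ ?_ ?_
    · simp
    · simp +contextual [Prod.ext_iff]
    · rintro ⟨x, y⟩ hxy
      simp only [mem_offDiag, Finset.mem_map] at hxy
      obtain ⟨⟨a, ha, rfl⟩, ⟨b, hb, rfl⟩, hne⟩ := hxy
      exact ⟨(a, b), mem_offDiag.2 ⟨ha, hb, fun hab => hne (congrArg _ hab)⟩, rfl⟩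
    · simp
  rw [h1, sum_congr rfl fun p hp => h.v₂_latticePoint (mem_offDiag.1 hp).2.2, ← ereal_coe_sum,
    ← sum_filter, sum_const]
  congr 1
  have := card_adjacent A
  rw [nsmul_eq_mul, mul_neg_one]
  congr 1
  exact_mod_cast this

/-- A particle at height `1` is bonded to the substrate point below it; higher particles are not
bonded to the substrate. -/
lemma Admissible.finsum_substrate (h : Admissible β ε r₀ v₂ v₃) {a : ℤ × ℤ} (ha : 0 < a.2) :
    ∑ᶠ z ∈ substrate, v₂ (dist (latticePoint a) z) =
      ((if a.2 = 1 then -1 else 0 : ℝ) : EReal) := by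
  have key : ∀ k : ℤ × ℤ, k.2 ≤ 0 → ¬ (a.2 = 1 ∧ k = (a.1, 0)) →
      v₂ (dist (latticePoint a) (latticePoint k)) = 0 := by
    intro k hk hak
    rw [h.v₂_latticePoint (by rintro rfl; omega), if_neg, EReal.coe_zero]
    intro hs
    apply hak
    rcases int_sq_add_sq_eq_one hs with hs | hs | hs | hs <;>
      first | omega | exact ⟨by omega, by ext <;> simp only <;> omega⟩
  rw [finsum_mem_def]
  split_ifs with h1
  · rw [finsum_eq_single _ (latticePoint (a.1, 0)), Set.indicator_of_mem,
      h.v₂_latticePoint (by rintro h; simp [Prod.ext_iff] at h; omega), if_pos]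
    · simp [h1]
    · exact ⟨latticePoint_mem _, by simp⟩
    · intro z hz
      rw [Set.indicator_apply_eq_zero]
      rintro ⟨hzl, hz0⟩
      obtain ⟨k, rfl⟩ := exists_latticePoint hzl
      rw [latticePoint_one, Int.cast_nonpos] at hz0
      exact key k hz0 fun hk => hz (by rw [hk.2])
  · rw [EReal.coe_zero]
    convert finsum_zero with z
    rw [Set.indicator_apply_eq_zero]
    rintro ⟨hzl, hz0⟩
    obtain ⟨k, rfl⟩ := exists_latticePoint hzl
    rw [latticePoint_one, Int.cast_nonpos] at hz0
    exact key k hz0 fun hk => h1 hk.1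

lemma toIcoMod_arg_I : toIcoMod Real.two_pi_pos 0 Complex.I.arg = Real.pi / 2 := by
  rw [Complex.arg_I, toIcoMod_eq_self]
  constructor <;> linarith [Real.pi_pos]

lemma toIcoMod_arg_neg_one : toIcoMod Real.two_pi_pos 0 (-1 : ℂ).arg = Real.pi := by
  rw [Complex.arg_neg_one, toIcoMod_eq_self]
  constructor <;> linarith [Real.pi_pos]

lemma toIcoMod_arg_neg_I : toIcoMod Real.two_pi_pos 0 (-Complex.I).arg = 3 * Real.pi / 2 := by
  rw [Complex.arg_neg_I, ← toIcoMod_add_right, (toIcoMod_eq_self _).2]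
  · ring
  · constructor <;> linarith [Real.pi_pos]

/-- The three-body energy vanishes on the lattice, since its bond angles are right or straight. -/
lemma Admissible.v₃_bondAngle (h : Admissible β ε r₀ v₂ v₃) {x y z : Plane}
    (hx : x ∈ squareLattice) (hy : y ∈ squareLattice) (hz : z ∈ squareLattice)
    (hxy : x ≠ y) (hyz : y ≠ z) (hxz : x ≠ z) (dxy : dist x y < r₀) (dyz : dist y z < r₀) :
    v₃ (bondAngle x y z) = 0 := by
  obtain ⟨a, rfl⟩ := exists_latticePoint hx
  obtain ⟨b, rfl⟩ := exists_latticePoint hy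
  obtain ⟨c, rfl⟩ := exists_latticePoint hz
  have unit : ∀ p q : ℤ × ℤ, latticePoint p ≠ latticePoint q →
      dist (latticePoint p) (latticePoint q) < r₀ → (p.1 - q.1) ^ 2 + (p.2 - q.2) ^ 2 = 1 := by
    intro p q hpq hd
    have hpos := int_sq_add_sq_pos (fun h => hpq (congrArg latticePoint h))
    rw [dist_latticePoint] at hd
    have := lt_of_not_ge fun hge => (hd.trans h.range_lt_sqrt_two).not_ge (Real.sqrt_le_sqrt hge)
    have : (p.1 - q.1) ^ 2 + (p.2 - q.2) ^ 2 < 2 := by exact_mod_cast this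
    omega
  have hu := int_sq_add_sq_eq_one (unit a b hxy dxy)
  have hv := int_sq_add_sq_eq_one (unit c b hyz.symm (dist_comm (latticePoint b) _ ▸ dyz))
  have hac : a ≠ c := fun h => hxz (congrArg latticePoint h)
  have hne : ¬ (a.1 - b.1 = c.1 - b.1 ∧ a.2 - b.2 = c.2 - b.2) := by
    rintro ⟨h1, h2⟩
    exact hac (by ext <;> omega)
  have hcomp : ∀ p q : ℤ × ℤ, toComplex (latticePoint p - latticePoint q) =
      ((p.1 - q.1 : ℤ) : ℂ) + ((p.2 - q.2 : ℤ) : ℂ) * Complex.I := by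
    intro p q
    apply Complex.ext <;> simp [toComplex]
  apply h.v₃_zero
  rw [bondAngle, hcomp, hcomp]
  have : (((a.1 - b.1 : ℤ) : ℂ) + ((a.2 - b.2 : ℤ) : ℂ) * Complex.I) /
      (((c.1 - b.1 : ℤ) : ℂ) + ((c.2 - b.2 : ℤ) : ℂ) * Complex.I) ∈
        ({Complex.I, -1, -Complex.I} : Set ℂ) := by
    rcases hu with ⟨h1, h2⟩ | ⟨h1, h2⟩ | ⟨h1, h2⟩ | ⟨h1, h2⟩ <;>
    rcases hv with ⟨h3, h4⟩ | ⟨h3, h4⟩ | ⟨h3, h4⟩ | ⟨h3, h4⟩ <;>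
    rw [h1, h2, h3, h4] at hne ⊢ <;> simp [neg_div, div_neg] at hne ⊢
  rcases this with h | h | h <;> rw [h]
  · exact .inl toIcoMod_arg_I
  · exact .inr (.inl toIcoMod_arg_neg_one)
  · exact .inr (.inr toIcoMod_arg_neg_I)

/-- The energy of a lattice configuration in terms of its ends and its contact with the
substrate. -/
theorem Admissible.energy_map (h : Admissible β ε r₀ v₂ v₃) {A : Finset (ℤ × ℤ)}
    (hA : ∀ a ∈ A, 0 < a.2) :
    energy β r₀ v₂ v₃ (A.map latticePoint) =
      ((-(2 * #A) + #(rightEnds A) + #(upperEnds A) - β * #(base A) : ℝ) : EReal) := by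
  have h2 : ∑ x ∈ A.map latticePoint, ∑ᶠ z ∈ substrate, v₂ (dist x z) =
      ((-#(base A) : ℝ) : EReal) := by
    rw [sum_map, sum_congr rfl fun a ha => h.finsum_substrate (hA a ha), ← ereal_coe_sum,
      ← sum_filter, sum_const, nsmul_eq_mul, mul_neg_one, base]
  have hlat : ((A.map latticePoint : Finset Plane) : Set Plane) ∪ substrate ⊆ squareLattice := by
    rintro x (hx | hx)
    · obtain ⟨a, -, rfl⟩ := Finset.mem_map.1 (mem_coe.1 hx)
      exact latticePoint_mem a
    · exact hx.1
  have h3 : ∑ᶠ t ∈ bondTriples r₀ (A.map latticePoint), v₃ (bondAngle t.1 t.2.1 t.2.2) = 0 := by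
    refine finsum_mem_of_eqOn_zero ?_
    rintro ⟨x, y, z⟩ ⟨hx, hy, hz, hxy, hyz, hxz, dxy, dyz⟩
    exact h.v₃_bondAngle (hlat hx) (hlat hy) (hlat hz) hxy hyz hxz dxy dyz
  rw [energy, h.sum_pair, h2, h3, ← EReal.coe_mul, ← EReal.coe_mul, ← EReal.coe_add,
    ← EReal.coe_add]
  congr 1
  ring

/-! ### Lattice minimizers fill a box almost completely -/

/-- A lattice minimizer is at least as good as the columnwise filling with the same number of
rows. This forces it to have as few ends and as much contact with the substrate as possible. -/
theorem Admissible.minimizer_subset_box (h : Admissible β ε r₀ v₂ v₃) (hβ₀ : 0 < β) (hβ₁ : β < 1)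
    {N : ℕ} (hN : 0 < N) {C : Finset Plane} (hC : IsMinimizer β r₀ v₂ v₃ N C)
    (hlat : (C : Set Plane) ⊆ squareLattice) (hleft : LeftNormalized C) :
    ∃ (A : Finset (ℤ × ℤ)) (m : ℕ), C = A.map latticePoint ∧ #A = N ∧ m ∈ Set.Icc 1 N ∧
      heightEnergy β N m = minEnergy β N ∧
      A ⊆ Icc 1 ⌈(N : ℝ) / m⌉ ×ˢ Icc 1 (m : ℤ) := by
  obtain ⟨A, rfl⟩ := exists_map_latticePoint hlat
  have hAN : #A = N := by simpa using hC.1.1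
  have hpos : ∀ a ∈ A, 0 < a.2 := by
    intro a ha
    have : 0 < latticePoint a 1 := hC.1.2 (mem_coe.2 (mem_map_of_mem _ ha))
    simpa using this
  have hA0 : A.Nonempty := card_pos.1 (hAN ▸ hN)
  have hupper : ∀ m' ∈ Set.Icc 1 N, (#(rightEnds A) + #(upperEnds A) - β * #(base A) : ℝ) ≤
      m' + (1 - β) * ⌈(N : ℝ) / m'⌉ := by
    intro m' hm'
    have hm0 : 0 < m' := hm'.1
    have hBpos : ∀ a ∈ columnFilling N m', 0 < a.2 := by
      rintro ⟨i, j⟩ hij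
      have := (mem_columnFilling hm0).1 hij
      simp only
      omega
    have := isMinOn_iff.1 hC.2 ((columnFilling N m').map latticePoint)
      ⟨by simp [card_columnFilling], by
      intro x hx
      obtain ⟨a, ha, rfl⟩ := Finset.mem_map.1 (mem_coe.1 hx)
      have := hBpos a ha
      simpa [upperHalf] using this⟩
    rw [h.energy_map hpos, h.energy_map hBpos, EReal.coe_le_coe_iff, card_columnFilling, hAN]
      at this
    have h1 : (#(rightEnds (columnFilling N m')) : ℝ) ≤ m' :=
      mod_cast card_rightEnds_columnFilling hm0
    have h2 : (#(upperEnds (columnFilling N m')) : ℝ) ≤ #(base (columnFilling N m')) :=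
      mod_cast card_upperEnds_columnFilling hm0
    have h3 : (#(base (columnFilling N m')) : ℝ) ≤ ⌈(N : ℝ) / m'⌉ :=
      mod_cast card_base_columnFilling hm0
    nlinarith [mul_le_mul_of_nonneg_left h3 (sub_nonneg.2 hβ₁.le)]
  have hrows0 : 0 < #(rows A) := card_pos.2 (hA0.image _)
  have hrows : #(rows A) ∈ Set.Icc 1 N := ⟨hrows0, hAN ▸ card_image_le⟩
  have hR : (#(rows A) : ℝ) ≤ #(rightEnds A) := mod_cast card_rows_le A
  have hU : (#(cols A) : ℝ) ≤ #(upperEnds A) := mod_cast card_cols_le A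
  have hb : (#(base A) : ℝ) ≤ #(cols A) := mod_cast card_base_le A
  have hceil : (⌈(N : ℝ) / #(rows A)⌉ : ℝ) ≤ #(cols A) := by
    have : ⌈(N : ℝ) / #(rows A)⌉ ≤ (#(cols A) : ℤ) := by
      rw [Int.ceil_le, Int.cast_natCast, div_le_iff₀ (by exact_mod_cast hrows0)]
      exact_mod_cast hAN ▸ card_le_cols_mul_rows A
    exact_mod_cast this
  have hE := hupper _ hrows
  have hβb : β * #(base A) ≤ β * #(cols A) := mul_le_mul_of_nonneg_left hb hβ₀.le
  have hβc := mul_le_mul_of_nonneg_left hceil (sub_nonneg.2 hβ₁.le)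
  have eR : #(rightEnds A) ≤ #(rows A) := by
    have : (#(rightEnds A) : ℝ) ≤ #(rows A) := by linarith
    exact_mod_cast this
  have eU : #(upperEnds A) ≤ #(cols A) := by
    have : (#(upperEnds A) : ℝ) ≤ #(cols A) := by linarith
    exact_mod_cast this
  have eb : #(cols A) ≤ #(base A) := by
    have : β * (#(cols A) : ℝ) ≤ β * #(base A) := by linarith
    exact_mod_cast le_of_mul_le_mul_left this hβ₀
  have ec : (#(cols A) : ℤ) = ⌈(N : ℝ) / #(rows A)⌉ := by
    have : (1 - β) * (#(cols A) : ℝ) ≤ (1 - β) * ⌈(N : ℝ) / #(rows A)⌉ := by linarith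
    have := le_antisymm (le_of_mul_le_mul_left this (sub_pos.2 hβ₁)) hceil
    exact_mod_cast this
  refine ⟨A, #(rows A), rfl, hAN, hrows, ?_, ?_⟩
  · refine (IsLeast.csInf_eq ⟨Set.mem_image_of_mem _ hrows, ?_⟩).symm
    rintro - ⟨m', hm', rfl⟩
    have := hupper m' hm'
    simp only [heightEnergy]
    linarith
  · rw [← ec]
    refine subset_box hpos ?_ ?_ eR eU eb
    · intro a ha
      have : (1 : ℝ) ≤ (a.1 : ℝ) := hleft.2 ⟨_, mem_coe.2 (mem_map_of_mem _ ha), rfl⟩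
      exact_mod_cast this
    · obtain ⟨x, hx, hx1⟩ := hleft.1
      obtain ⟨a, ha, rfl⟩ := Finset.mem_map.1 (mem_coe.1 hx)
      exact ⟨a, ha, by simpa using hx1⟩

end Winterbottom

namespace Winterbottom

/-! ### Asymptotics of optimal heights -/

/-- Every optimal height is within `O(N^{1/4})` of `√(1-β) √N`: compare with the height
`⌈√(1-β) √N⌉`. -/
lemma sq_sub_le_of_optimal {β : ℝ} (hβ₀ : 0 < β) (hβ₁ : β < 1) {N m : ℕ} (hN : 0 < N)
    (hm : m ∈ Set.Icc 1 N) (hopt : heightEnergy β N m = minEnergy β N) :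
    ((m : ℝ) - √(1 - β) * √N) ^ 2 ≤ 4 * (√N + 1) := by
  set a := √(1 - β) with ha
  set t := √(N : ℝ) with ht
  have ha0 : 0 < a := Real.sqrt_pos.2 (by linarith)
  have ha2 : a ^ 2 = 1 - β := Real.sq_sqrt (by linarith)
  have ha1 : a ≤ 1 := by nlinarith
  have hN1 : (1 : ℝ) ≤ N := mod_cast hN
  have ht1 : 1 ≤ t := Real.one_le_sqrt.2 hN1
  have ht2 : t ^ 2 = N := Real.sq_sqrt (by positivity)
  have hat : 0 < a * t := by positivity
  obtain ⟨k, hk⟩ : ∃ k, k = ⌈a * t⌉₊ := ⟨_, rfl⟩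
  have hk1 : a * t ≤ k := hk ▸ Nat.le_ceil _
  have hk2 : (k : ℝ) < a * t + 1 := hk ▸ Nat.ceil_lt_add_one hat.le
  have hkmem : k ∈ Set.Icc 1 N := by
    refine ⟨hk ▸ Nat.ceil_pos.2 hat, hk ▸ Nat.ceil_le.2 ?_⟩
    nlinarith
  have hle : heightEnergy β N m ≤ heightEnergy β N k := by
    rw [hopt, minEnergy]
    exact csInf_le (((Set.finite_Icc 1 N).image _).bddBelow) (Set.mem_image_of_mem _ hkmem)
  have hm0 : (0 : ℝ) < m := mod_cast hm.1
  have h1 : (N : ℝ) / m ≤ ⌈(N : ℝ) / m⌉ := Int.le_ceil _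
  have h2 : (⌈(N : ℝ) / k⌉ : ℝ) < N / k + 1 := Int.ceil_lt_add_one _
  have h3 : (N : ℝ) / k ≤ N / (a * t) := by gcongr
  have h4 : a ^ 2 * ((N : ℝ) / (a * t)) = a * t := by
    rw [← ht2]
    field_simp
  have h5 : a ^ 2 * ((N : ℝ) / m) * m = (a * t) ^ 2 := by
    rw [mul_assoc, div_mul_cancel₀ _ hm0.ne', mul_pow, ht2]
  have h6 : m + a ^ 2 * ((N : ℝ) / m) ≤ 2 * (a * t) + 2 := by
    simp only [heightEnergy, ← ha2] at hle
    nlinarith [mul_le_mul_of_nonneg_left h1 (sq_nonneg a),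
      mul_le_mul_of_nonneg_left (h2.le.trans (add_le_add_left h3 1)) (sq_nonneg a)]
  have h7 : (m : ℝ) ≤ 2 * (t + 1) := by
    have : 0 ≤ a ^ 2 * ((N : ℝ) / m) := by positivity
    nlinarith
  nlinarith [mul_le_mul_of_nonneg_right h6 hm0.le]

lemma tendsto_sqrt_natCast : Tendsto (fun N : ℕ => √(N : ℝ)) atTop atTop :=
  Real.tendsto_sqrt_atTop.comp tendsto_natCast_atTop_atTop

lemma tendsto_optimal_height {β : ℝ} (hβ₀ : 0 < β) (hβ₁ : β < 1) {m : ℕ → ℕ}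
    (hm : ∀ᶠ N in atTop, m N ∈ Set.Icc 1 N ∧ heightEnergy β N (m N) = minEnergy β N) :
    Tendsto (fun N => (m N : ℝ) / √N) atTop (𝓝 (√(1 - β))) := by
  rw [tendsto_iff_dist_tendsto_zero]
  have hlim : Tendsto (fun N : ℕ => √(4 * ((√(N : ℝ))⁻¹ + (√(N : ℝ))⁻¹ ^ 2))) atTop (𝓝 0) := by
    have h := tendsto_inv_atTop_zero.comp tendsto_sqrt_natCast
    simpa using ((h.add (h.pow 2)).const_mul 4).sqrt
  refine squeeze_zero' (.of_forall fun _ => dist_nonneg) ?_ hlim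
  filter_upwards [hm, eventually_gt_atTop 0] with N hN hN0
  have ht : 0 < √(N : ℝ) := Real.sqrt_pos.2 (mod_cast hN0)
  rw [Real.dist_eq]
  apply Real.abs_le_sqrt
  have h := sq_sub_le_of_optimal hβ₀ hβ₁ hN0 hN.1 hN.2
  have e1 : ((m N : ℝ) / √N - √(1 - β)) ^ 2 = (m N - √(1 - β) * √N) ^ 2 / √N ^ 2 := by
    field_simp
  have e2 : 4 * ((√(N : ℝ))⁻¹ + (√(N : ℝ))⁻¹ ^ 2) = 4 * (√N + 1) / √N ^ 2 := by
    field_simp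
  rw [e1, e2]
  gcongr

lemma tendsto_optimal_width {β : ℝ} (hβ₁ : β < 1) {m : ℕ → ℕ}
    (hm : Tendsto (fun N => (m N : ℝ) / √N) atTop (𝓝 (√(1 - β)))) :
    Tendsto (fun N : ℕ => (⌈(N : ℝ) / m N⌉ : ℝ) / √N) atTop (𝓝 (1 / √(1 - β))) := by
  have ha : √(1 - β) ≠ 0 := (Real.sqrt_pos.2 (by linarith)).ne'
  have h1 : Tendsto (fun N => ((m N : ℝ) / √N)⁻¹) atTop (𝓝 (1 / √(1 - β))) := by
    rw [one_div]
    exact hm.inv₀ ha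
  have h2 : Tendsto (fun N => ((m N : ℝ) / √N)⁻¹ + (√(N : ℝ))⁻¹) atTop (𝓝 (1 / √(1 - β))) := by
    simpa using h1.add (tendsto_inv_atTop_zero.comp tendsto_sqrt_natCast)
  refine tendsto_of_tendsto_of_tendsto_of_le_of_le' h1 h2 ?_ ?_
  all_goals
    filter_upwards [eventually_gt_atTop 0] with N hN0
    have ht : 0 < √(N : ℝ) := Real.sqrt_pos.2 (mod_cast hN0)
    have e : ((m N : ℝ) / √N)⁻¹ = ((N : ℝ) / m N) / √N := by
      rw [inv_div, div_right_comm, Real.div_sqrt]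
    rw [e]
  · gcongr
    exact Int.le_ceil _
  · rw [← one_div, ← add_div]
    gcongr
    exact (Int.ceil_lt_add_one _).le

lemma hStar_spec (β : ℝ) {N : ℕ} (hN : 0 < N) :
    hStar β N ∈ Set.Icc 1 N ∧ heightEnergy β N (hStar β N) = minEnergy β N := by
  refine Nat.sSup_mem (s := {h | h ∈ Set.Icc 1 N ∧ heightEnergy β N h = minEnergy β N}) ?_
    ⟨N, fun h hh => hh.1.2⟩
  obtain ⟨h, hh, he⟩ := Set.Nonempty.csInf_mem (s := heightEnergy β N '' Set.Icc 1 N)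
    ⟨_, Set.mem_image_of_mem _ (Set.mem_Icc.2 ⟨le_rfl, hN⟩)⟩ ((Set.finite_Icc 1 N).image _)
  exact ⟨h, hh, he⟩

/-! ### Riemann sums over growing lattice boxes -/

/-- The index of the half-open cell of side `1 / t` that contains `x`; the cell with index `k` has
`k / t` as its upper right corner. -/
noncomputable def cellIndex (t : ℝ) (x : Plane) : ℤ × ℤ := (⌈t * x 0⌉, ⌈t * x 1⌉)

lemma measurable_cellIndex (t : ℝ) : Measurable (cellIndex t) := by
  unfold cellIndex
  fun_prop

lemma volume_cell {t : ℝ} (ht : 0 < t) (k : ℤ × ℤ) :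
    volume.real (cellIndex t ⁻¹' {k}) = (t ^ 2)⁻¹ := by
  have h1 : cellIndex t ⁻¹' {k} = WithLp.ofLp ⁻¹'
      (Set.univ.pi fun i => Set.Ioc ((![(k.1 : ℝ), k.2] i - 1) / t) (![(k.1 : ℝ), k.2] i / t)) := by
    ext x
    simp only [cellIndex, Set.mem_preimage, Set.mem_singleton_iff, Prod.ext_iff, Int.ceil_eq_iff,
      Set.mem_univ_pi, Fin.forall_fin_two, Set.mem_Ioc, Matrix.cons_val_zero, Matrix.cons_val_one,
      div_lt_iff₀ ht, le_div_iff₀ ht, mul_comm t]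
  rw [h1, measureReal_def, (PiLp.volume_preserving_ofLp (Fin 2)).measure_preimage
    (MeasurableSet.univ_pi fun i => measurableSet_Ioc).nullMeasurableSet, Real.volume_pi_Ioc]
  have h2 : ∀ c : ℝ, c / t - (c - 1) / t = t⁻¹ := fun c => by ring
  simp only [h2, Fin.prod_univ_two]
  rw [ENNReal.toReal_mul, ENNReal.toReal_ofReal (by positivity)]
  field_simp

lemma ae_coord_ne (i : Fin 2) (c : ℝ) : ∀ᵐ x : Plane, x i ≠ c :=
  (PiLp.volume_preserving_ofLp (Fin 2)).quasiMeasurePreserving.ae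
    (p := fun y : Fin 2 → ℝ => y i ≠ c)
    (Measure.ae_eval_ne (μ := fun _ : Fin 2 => (volume : Measure ℝ)) i c)

lemma norm_zeroAtInfty_le (f : ZeroAtInftyContinuousMap Plane ℝ) (x : Plane) : |f x| ≤ ‖f‖ :=
  f.toBCF.norm_coe_le_norm x

lemma tendsto_ceil_mul_div {t : ℕ → ℝ} (ht : Tendsto t atTop atTop) (c : ℝ) :
    Tendsto (fun N => (t N)⁻¹ * (⌈t N * c⌉ : ℝ)) atTop (𝓝 c) := by
  have h2 : Tendsto (fun N => c + (t N)⁻¹) atTop (𝓝 c) := by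
    simpa using tendsto_const_nhds.add (tendsto_inv_atTop_zero.comp ht)
  refine tendsto_of_tendsto_of_tendsto_of_le_of_le' tendsto_const_nhds h2 ?_ ?_
  all_goals filter_upwards [ht.eventually_gt_atTop 0] with N hN
  · rw [inv_mul_eq_div, le_div_iff₀ hN, mul_comm]
    exact Int.le_ceil _
  · rw [inv_mul_eq_div, div_le_iff₀ hN, add_mul, inv_mul_cancel₀ hN.ne', mul_comm]
    exact (Int.ceil_lt_add_one _).le

/-- Off the boundary of the limit interval, membership in the rescaled interval `(0, w N / t N]`
is eventually that in `[0, a]`. -/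
lemma eventually_ceil_mem_iff {t : ℕ → ℝ} (ht : Tendsto t atTop atTop) {w : ℕ → ℤ} {a c : ℝ}
    (hw : Tendsto (fun N => (w N : ℝ) / t N) atTop (𝓝 a)) (hc₀ : c ≠ 0) (hca : c ≠ a) :
    ∀ᶠ N in atTop, (⌈t N * c⌉ ∈ Finset.Icc 1 (w N) ↔ c ∈ Set.Icc 0 a) := by
  have hpos : ∀ᶠ N in atTop, (1 ≤ ⌈t N * c⌉ ↔ 0 ≤ c) := by
    filter_upwards [ht.eventually_gt_atTop 0] with N hN
    rw [Int.one_le_ceil_iff, mul_pos_iff_of_pos_left hN]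
    exact ⟨le_of_lt, fun h => h.lt_of_ne hc₀.symm⟩
  have hup : ∀ᶠ N in atTop, (⌈t N * c⌉ ≤ w N ↔ c ≤ a) := by
    rcases hca.lt_or_gt with h | h
    · filter_upwards [ht.eventually_gt_atTop 0, hw.eventually_const_lt h] with N hN hN'
      rw [Int.ceil_le, ← le_div_iff₀' hN]
      exact iff_of_true hN'.le h.le
    · filter_upwards [ht.eventually_gt_atTop 0, hw.eventually_lt_const h] with N hN hN'
      rw [Int.ceil_le, ← le_div_iff₀' hN]
      exact iff_of_false hN'.not_ge h.not_ge
  filter_upwards [hpos, hup] with N h1 h2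
  rw [Finset.mem_Icc, Set.mem_Icc, h1, h2]

/-- The rescaled sum over a box is the integral of the step function that is constant on the
cells; dominated convergence identifies the limit. -/
lemma tendsto_box_sum (f : ZeroAtInftyContinuousMap Plane ℝ) {t : ℕ → ℝ}
    (ht : Tendsto t atTop atTop) {w h : ℕ → ℤ} {a b : ℝ}
    (hw : Tendsto (fun N => (w N : ℝ) / t N) atTop (𝓝 a))
    (hh : Tendsto (fun N => (h N : ℝ) / t N) atTop (𝓝 b)) :
    Tendsto (fun N => (t N ^ 2)⁻¹ *
        ∑ k ∈ Finset.Icc 1 (w N) ×ˢ Finset.Icc 1 (h N), f ((t N)⁻¹ • latticePoint k))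
      atTop (𝓝 (∫ x in {x : Plane | x 0 ∈ Set.Icc 0 a ∧ x 1 ∈ Set.Icc 0 b}, f x)) := by
  set box : ℕ → Finset (ℤ × ℤ) := fun N => Finset.Icc 1 (w N) ×ˢ Finset.Icc 1 (h N) with hbox
  set rect : ℝ → ℝ → Set Plane := fun a b => {x | x 0 ∈ Set.Icc 0 a ∧ x 1 ∈ Set.Icc 0 b} with hr
  set G : ℕ → Plane → ℝ := fun N x => ∑ k ∈ box N,
    (cellIndex (t N) ⁻¹' {k}).indicator (fun _ => f ((t N)⁻¹ • latticePoint k)) x with hG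
  have hGval : ∀ N x, G N x = if cellIndex (t N) x ∈ box N then
      f ((t N)⁻¹ • latticePoint (cellIndex (t N) x)) else 0 := by
    intro N x
    have : ∀ k, (cellIndex (t N) ⁻¹' {k}).indicator (fun _ => f ((t N)⁻¹ • latticePoint k)) x =
        if cellIndex (t N) x = k then f ((t N)⁻¹ • latticePoint k) else 0 := by
      intro k
      split_ifs with hk
      · exact Set.indicator_of_mem (by exact hk) _
      · exact Set.indicator_of_notMem (by exact hk) _
    simp only [hG, this]
    rw [Finset.sum_ite_eq]
  have hcell : ∀ N k, MeasurableSet (cellIndex (t N) ⁻¹' {k}) := fun N k =>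
    measurable_cellIndex _ (measurableSet_singleton k)
  have hrect : ∀ a b, MeasurableSet (rect a b) := fun a b => by
    have h0 : Measurable fun x : Plane => x 0 := by fun_prop
    have h1 : Measurable fun x : Plane => x 1 := by fun_prop
    exact (h0 measurableSet_Icc).inter (h1 measurableSet_Icc)
  have hfin : ∀ a b, volume (rect a b) ≠ ⊤ := fun a b => by
    have : rect a b = WithLp.ofLp ⁻¹' (Set.univ.pi fun i => Set.Icc 0 (![a, b] i)) := by
      ext x
      simp only [hr, Set.mem_preimage, Set.mem_univ_pi, Fin.forall_fin_two]
      rfl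
    rw [this, (PiLp.volume_preserving_ofLp (Fin 2)).measure_preimage
      (MeasurableSet.univ_pi fun i => measurableSet_Icc).nullMeasurableSet]
    exact (isCompact_univ_pi fun i => isCompact_Icc).measure_lt_top.ne
  have hGint : ∀ᶠ N in atTop, ∫ x, G N x =
      (t N ^ 2)⁻¹ * ∑ k ∈ box N, f ((t N)⁻¹ • latticePoint k) := by
    filter_upwards [ht.eventually_gt_atTop 0] with N hN
    rw [hG, integral_finsetSum, Finset.mul_sum]
    · refine Finset.sum_congr rfl fun k _ => ?_
      rw [integral_indicator_const _ (hcell N k), volume_cell hN, smul_eq_mul]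
    · intro k _
      refine (integrable_indicator_iff (hcell N k)).2 (integrableOn_const (hs := ?_))
      intro htop
      have := volume_cell hN k
      rw [measureReal_def, htop, ENNReal.toReal_top] at this
      exact (inv_pos.2 (pow_pos hN 2)).ne this
  rw [← integral_indicator (hrect a b)]
  refine Tendsto.congr' hGint ?_
  refine tendsto_integral_filter_of_dominated_convergence
    ((rect (a + 1) (b + 1)).indicator fun _ => ‖f‖) ?_ ?_ ?_ ?_
  · refine .of_forall fun N => Measurable.aestronglyMeasurable ?_
    exact Finset.measurable_sum _ fun k _ => measurable_const.indicator (hcell N k)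
  · filter_upwards [ht.eventually_gt_atTop 0, hw.eventually_lt_const (lt_add_one a),
      hh.eventually_lt_const (lt_add_one b)] with N hN hwN hhN
    refine .of_forall fun x => ?_
    rw [hGval]
    split_ifs with hx
    · rw [Set.indicator_of_mem]
      · exact norm_zeroAtInfty_le f _
      · simp only [hbox, Finset.mem_product, Finset.mem_Icc, cellIndex, Int.one_le_ceil_iff,
          Int.ceil_le, mul_pos_iff_of_pos_left hN, ← le_div_iff₀' hN] at hx
        exact ⟨⟨hx.1.1.le, hx.1.2.trans hwN.le⟩, ⟨hx.2.1.le, hx.2.2.trans hhN.le⟩⟩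
    · rw [norm_zero]
      exact Set.indicator_nonneg (fun _ _ => norm_nonneg f) x
  · exact (integrable_indicator_iff (hrect _ _)).2 (integrableOn_const (hs := hfin _ _))
  · filter_upwards [ae_coord_ne 0 0, ae_coord_ne 0 a, ae_coord_ne 1 0, ae_coord_ne 1 b]
      with x h00 h0a h10 h1b
    have hev : ∀ᶠ N in atTop, (cellIndex (t N) x ∈ box N ↔ x ∈ rect a b) := by
      filter_upwards [eventually_ceil_mem_iff ht hw h00 h0a, eventually_ceil_mem_iff ht hh h10 h1b]
        with N h1 h2
      rw [hbox, Finset.mem_product]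
      exact and_congr h1 h2
    by_cases hx : x ∈ rect a b
    · rw [Set.indicator_of_mem hx]
      have hlim : Tendsto (fun N => (t N)⁻¹ • latticePoint (cellIndex (t N) x)) atTop (𝓝 x) := by
        have hcoord : Tendsto (fun N => WithLp.ofLp ((t N)⁻¹ • latticePoint (cellIndex (t N) x)))
            atTop (𝓝 (WithLp.ofLp x)) := by
          rw [tendsto_pi_nhds, Fin.forall_fin_two]
          exact ⟨by simpa [cellIndex] using tendsto_ceil_mul_div ht (x 0),
            by simpa [cellIndex] using tendsto_ceil_mul_div ht (x 1)⟩
        exact ((PiLp.continuous_toLp 2 _).tendsto _).comp hcoord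
      refine Tendsto.congr' ?_ ((f.continuous.tendsto x).comp hlim)
      filter_upwards [hev] with N hN
      rw [hGval, if_pos (hN.2 hx)]
      rfl
    · rw [Set.indicator_of_notMem hx]
      refine tendsto_const_nhds.congr' ?_
      filter_upwards [hev] with N hN
      rw [hGval, if_neg fun h => hx (hN.1 h)]

/-! ### Convergence of the empirical measures -/

lemma integral_empiricalMeasure (f : ZeroAtInftyContinuousMap Plane ℝ) {A : Finset (ℤ × ℤ)}
    {N : ℕ} (hA : A.card = N) :
    ∫ x, f x ∂(empiricalMeasure (A.map latticePoint)) =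
      (N : ℝ)⁻¹ * ∑ k ∈ A, f ((√(N : ℝ))⁻¹ • latticePoint k) := by
  rw [empiricalMeasure, integral_smul_measure, integral_finsetSum_measure]
  · simp [hA, integral_dirac]
  · intro x _
    exact integrable_dirac (by simp)

/-- Passing from a box to a subset of it changes a sum by at most the number of missing points. -/
lemma abs_sum_sub_sum_le {ι : Type*} {A B : Finset ι} (hAB : A ⊆ B) {g : ι → ℝ} {M : ℝ}
    (hg : ∀ i, |g i| ≤ M) :
    |∑ i ∈ A, g i - ∑ i ∈ B, g i| ≤ (B.card - A.card) * M := by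
  classical
  rw [← Finset.sum_sdiff hAB, sub_add_cancel_right, abs_neg]
  refine (Finset.abs_sum_le_sum_abs _ _).trans
    ((Finset.sum_le_card_nsmul _ _ M fun i _ => hg i).trans ?_)
  rw [nsmul_eq_mul, Finset.card_sdiff_of_subset hAB, Nat.cast_sub (Finset.card_le_card hAB)]

end Winterbottom

open Winterbottom
theorem corollary2p5 (β : ℝ) (hβ₀ : 0 < β) (hβ₁ : β < 1) :
    Tendsto (fun N : ℕ => (N : ℝ) ^ (-(1 / 2) : ℝ) * (hStar β N : ℝ)) atTop (𝓝 (√(1 - β))) ∧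
    ∀ (ε r₀ : ℝ) (v₂ : ℝ → EReal) (v₃ : ℝ → ℝ), 0 < ε → ε < Real.pi / 10 →
      Admissible β ε r₀ v₂ v₃ →
      ∀ C : ℕ → Finset Plane,
        (∀ᶠ N in atTop, IsMinimizer β r₀ v₂ v₃ N (C N) ∧
          (C N : Set Plane) ⊆ squareLattice ∩ upperHalf ∧ LeftNormalized (C N)) →
        WeakStarTendsto (fun N => empiricalMeasure (C N))
          (volume.restrict (winterbottomRectangle β)) := by
  refine ⟨?_, ?_⟩
  · refine (tendsto_optimal_height hβ₀ hβ₁ (m := hStar β)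
      ((eventually_gt_atTop 0).mono fun N hN => hStar_spec β hN)).congr fun N => ?_
    rw [Real.rpow_neg (Nat.cast_nonneg N), ← Real.sqrt_eq_rpow, inv_mul_eq_div]
  intro ε r₀ v₂ v₃ _ _ hadm C hC f
  have hex : ∀ᶠ N in atTop, ∃ (A : Finset (ℤ × ℤ)) (m : ℕ), C N = A.map latticePoint ∧
      A.card = N ∧ m ∈ Set.Icc 1 N ∧ heightEnergy β N m = minEnergy β N ∧
      A ⊆ Finset.Icc 1 ⌈(N : ℝ) / m⌉ ×ˢ Finset.Icc 1 (m : ℤ) := by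
    filter_upwards [hC, eventually_gt_atTop 0] with N hN hN0
    exact hadm.minimizer_subset_box hβ₀ hβ₁ hN0 hN.1 (fun x hx => (hN.2.1 hx).1) hN.2.2
  choose! A m hA using hex.exists_forall_of_atTop.choose_spec
  replace hA := (eventually_ge_atTop hex.exists_forall_of_atTop.choose).mono hA
  have hh := tendsto_optimal_height hβ₀ hβ₁ (m := m)
    (hA.mono fun N hN => ⟨hN.2.2.1, hN.2.2.2.1⟩)
  have hw := tendsto_optimal_width hβ₁ hh
  have ha : √(1 - β) ≠ 0 := (Real.sqrt_pos.2 (by linarith)).ne'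
  -- Riemann sums over the enclosing boxes `[1, ⌈N / m N⌉] × [1, m N]`.
  have hbox := tendsto_box_sum f tendsto_sqrt_natCast (w := fun N => ⌈(N : ℝ) / m N⌉)
    (h := fun N => (m N : ℤ)) hw (by simpa using hh)
  -- The proportion of points of the box that are missing from `A N` tends to `0`.
  have hdefect : Tendsto (fun N : ℕ => ((⌈(N : ℝ) / m N⌉ : ℝ) / √N * (m N / √N) - 1) * ‖f‖) atTop
      (𝓝 0) := by
    have := ((hw.mul hh).sub_const 1).mul_const ‖f‖
    rwa [one_div_mul_cancel ha, sub_self, zero_mul] at this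
  have hdiff : Tendsto (fun N => ∫ x, f x ∂(empiricalMeasure (C N)) - (√(N : ℝ) ^ 2)⁻¹ *
      ∑ k ∈ Finset.Icc 1 ⌈(N : ℝ) / m N⌉ ×ˢ Finset.Icc 1 (m N : ℤ),
        f ((√(N : ℝ))⁻¹ • latticePoint k)) atTop (𝓝 0) := by
    refine squeeze_zero_norm' ?_ hdefect
    filter_upwards [hA, eventually_gt_atTop 0] with N hN hN0
    obtain ⟨hCA, hcard, hmN, -, hsub⟩ := hN
    have hN0' : (0 : ℝ) < N := mod_cast hN0
    have ht2 : √(N : ℝ) ^ 2 = N := Real.sq_sqrt hN0'.le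
    have hc0 : 0 ≤ ⌈(N : ℝ) / m N⌉ := Int.ceil_nonneg (by positivity)
    have hcB : ((Finset.Icc 1 ⌈(N : ℝ) / m N⌉ ×ˢ Finset.Icc 1 (m N : ℤ)).card : ℝ) =
        ⌈(N : ℝ) / m N⌉ * m N := by
      rw [Finset.card_product, Int.card_Icc, Int.card_Icc, Nat.cast_mul]
      congr 1
      · rw [add_sub_cancel_right]
        exact_mod_cast Int.toNat_of_nonneg hc0
      · simp
    have hle := abs_sum_sub_sum_le hsub
      (g := fun k => f ((√(N : ℝ))⁻¹ • latticePoint k)) fun k => norm_zeroAtInfty_le f _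
    rw [hCA, integral_empiricalMeasure f hcard, ht2, ← mul_sub, norm_mul, Real.norm_eq_abs,
      Real.norm_eq_abs, abs_of_pos (inv_pos.2 hN0')]
    refine (mul_le_mul_of_nonneg_left hle (inv_pos.2 hN0').le).trans_eq ?_
    rw [hcB, hcard, div_mul_div_comm, ← sq, ht2]
    field_simp
  simpa [winterbottomRectangle] using hdiff.add hbox
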